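/- Let $X$ be a real Banach space with dual $X^*$ and let $f:X\to\mathbb R$ be lower semicontinuous and quasidifferentiable at each point of $X$; the latter means that for each $x\in X$ the one-sided directional derivatives $f'(x;v)=\lim_{t\downarrow 0}\frac{f(x+tv)-f(x)}{t}$ exist for all $v\in X$ and $f'(x;\cdot)=h_1-h_2$ for some continuous sublinear functions $h_1,h_2:X\to\mathbb R$. Equivalently, there are nonempty convex weak$^*$ compact sets $A,B\subseteq X^*$ with $f'(x;v)=\sigma_A(v)-\sigma_B(v)$ for all $v\in X$, where $\sigma_A(v)=\max_{x^*\in A}\langle x^*,v\rangle$. For any such pair define $$\mathcal Df(x)=\partial_C(\sigma_A-\sigma_B)(0)\subseteq X^*,$$ the Clarke subdifferential at $0$ of $\sigma_A-\sigma_B$ (the Demyanov difference of $A$ and $B$); this set does not depend on the choice of the pair. Let $\operatorname{Argmin} f$ be the (possibly empty) set of global minimizers of $f$ and let $\operatorname{dist}(\cdot,S)$ denote the norm distance to $S\subseteq X^*$, with $\operatorname{dist}(\cdot,\varnothing)=+\infty$. Suppose that (i) (nondegeneracy) for some $\tau\in(0,+\infty]$, $\operatorname{dist}\Big(0,\ \bigcup_{x\in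 X\setminus\operatorname{Argmin} f}\mathcal Df(x)\Big)=\tau$; (ii) $\mathcal Df$ is norm-to-norm upper semicontinuous at each $\bar x\in\operatorname{Argmin} f$, in the sense that for every $\varepsilon>0$ there is $\delta>0$ such that $\mathcal Df(x)\subseteq\{x^*\in X^*:\operatorname{dist}(x^*,\mathcal Df(\bar x))\le\varepsilon\}$ whenever $\|x-\bar x\|\le\delta$. Then $f$ is not Gâteaux differentiable at any boundary point of $\operatorname{Argmin} f$; that is, for no $\bar x\in\partial(\operatorname{Argmin} f)$ is there an $x^*\in X^*$ such that $\lim_{t\to 0}\frac{f(\bar x+tv)-f(\bar x)}{t}=\langle x^*,v\rangle$ for all $v\in X$. -/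

import Mathlib

open Set Filter Topology
open scoped ENNReal

noncomputable section

namespace QuasiDiff

/-- The set of all global minimizers of `f` (empty if `f` does not attain its infimum). -/
def argmin {X : Type*} (f : X → ℝ) : Set X := {x | ∀ y, f x ≤ f y}

section Defs

variable {X : Type*} [NormedAddCommGroup X] [NormedSpace ℝ X]

/-- `d` is the (one-sided) directional derivative `f'(x; v)`. -/
def HasDirDerivAt (f : X → ℝ) (d : ℝ) (x v : X) : Prop :=
  Tendsto (fun t : ℝ => (f (x + t • v) - f x) / t) (𝓝[>] 0) (𝓝 d)

/-- Continuous sublinear (positively homogeneous and subadditive) functions on `X`. -/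
structure IsContSublinear (h : X → ℝ) : Prop where
  continuous : Continuous h
  pos_homogeneous : ∀ (t : ℝ) (v : X), 0 ≤ t → h (t • v) = t * h v
  subadditive : ∀ v w : X, h (v + w) ≤ h v + h w

/-- `f` is quasidifferentiable at `x`: it has directional derivatives in all directions, and
`f'(x; ·)` is a difference of two continuous sublinear functions. -/
def IsQuasidifferentiableAt (f : X → ℝ) (x : X) : Prop :=
  ∃ h₁ h₂ : X → ℝ, IsContSublinear h₁ ∧ IsContSublinear h₂ ∧
    ∀ v, HasDirDerivAt f (h₁ v - h₂ v) x v

/-- Nonempty, convex, weak-star compact subsets of the topological dual of `X`. -/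
structure IsCompConv (A : Set (StrongDual ℝ X)) : Prop where
  nonempty : A.Nonempty
  convex : Convex ℝ A
  weakStarCompact : IsCompact (WeakDual.toStrongDual ⁻¹' A : Set (WeakDual ℝ X))

/-- The support function `v ↦ sup {⟨L, v⟩ | L ∈ A}` of `A`. -/
def supportFun (A : Set (StrongDual ℝ X)) (v : X) : ℝ :=
  sSup ((fun L : StrongDual ℝ X => L v) '' A)

/-- The Clarke generalized directional derivative
`limsup_{y → x, t ↓ 0} (φ (y + t v) - φ y) / t`, as an extended real number. -/
def clarkeDeriv (φ : X → ℝ) (x v : X) : EReal :=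
  limsup (fun p : X × ℝ => (((φ (p.1 + p.2 • v) - φ p.1) / p.2 : ℝ) : EReal))
    (𝓝 x ×ˢ 𝓝[>] (0 : ℝ))

/-- The Clarke subdifferential of `φ` at `x`. -/
def clarkeSubdiff (φ : X → ℝ) (x : X) : Set (StrongDual ℝ X) :=
  {L | ∀ v, ((L v : ℝ) : EReal) ≤ clarkeDeriv φ x v}

/-- The Demyanov difference of `A` and `B`: the Clarke subdifferential at `0` of the difference
of the support functions. -/
def demyanovDiff (A B : Set (StrongDual ℝ X)) : Set (StrongDual ℝ X) :=
  clarkeSubdiff (fun v => supportFun A v - supportFun B v) 0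

/-- The pair `(A, B)` represents the quasidifferential of `f` at `x`: both sets are nonempty,
convex and weak-star compact, and `f'(x; ·)` is the difference of their support functions. -/
structure IsQuasidifferential (f : X → ℝ) (x : X) (A B : Set (StrongDual ℝ X)) : Prop where
  left : IsCompConv A
  right : IsCompConv B
  dirDeriv : ∀ v, HasDirDerivAt f (supportFun A v - supportFun B v) x v

/-- The Demyanov difference of the two members of a pair that represents the quasidifferential
of `f` at `x`. All such pairs give the same set (`demCoqd_eq`), so the union over the pairs
is the value for any one of them. -/
def demCoqd (f : X → ℝ) (x : X) : Set (StrongDual ℝ X) :=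
  {L | ∃ A B, IsQuasidifferential f x A B ∧ L ∈ demyanovDiff A B}

theorem demCoqd_eq {f : X → ℝ} {x : X} {A B : Set (StrongDual ℝ X)}
    (h : IsQuasidifferential f x A B) : demCoqd f x = demyanovDiff A B := by
  ext L
  constructor
  · rintro ⟨C, D, h', hL⟩
    have e : (fun v => supportFun C v - supportFun D v)
        = fun v => supportFun A v - supportFun B v :=
      funext fun v => tendsto_nhds_unique (h'.dirDeriv v) (h.dirDeriv v)
    unfold demyanovDiff at hL ⊢
    rwa [e] at hL
  · exact fun hL => ⟨A, B, h, hL⟩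

/-- `f` is Gateaux differentiable at `x`. -/
def GateauxDifferentiableAt (f : X → ℝ) (x : X) : Prop :=
  ∃ L : StrongDual ℝ X, ∀ v, HasLineDerivAt ℝ f (L v) x v

/-- Norm-to-norm upper semicontinuity at `x` of a set-valued map, with respect to the uniform
enlargements `{L | dist (L, F x) ≤ ε}` of its value. -/
def NormUSCAt (F : X → Set (StrongDual ℝ X)) (x : X) : Prop :=
  ∀ ε : ℝ, 0 < ε → ∃ δ : ℝ, 0 < δ ∧
    ∀ y ∈ Metric.closedBall x δ, F y ⊆ Metric.cthickening ε (F x)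

/-- Upper semicontinuity by arbitrary open supersets of the value `F x` implies `NormUSCAt`. -/
theorem normUSCAt_of_upperHemicontinuousAt {F : X → Set (StrongDual ℝ X)} {x : X}
    (h : UpperHemicontinuousAt F x) : NormUSCAt F x := by
  intro ε hε
  have h1 := h.forall_isOpen _ (Metric.isOpen_thickening (δ := ε) (E := F x))
    (Metric.self_subset_thickening hε _)
  obtain ⟨δ, hδ, H⟩ := Metric.nhds_basis_closedBall.eventually_iff.1 h1
  exact ⟨δ, hδ, fun y hy => (H hy).trans (Metric.thickening_subset_cthickening _ _)⟩

end Defs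

end QuasiDiff

end

/-! Lower semicontinuity makes `argmin f` closed, so a boundary point `x` is a minimizer. Gateaux
differentiability there forces every directional derivative to vanish, hence `demCoqd f x ⊆ {0}`.
Upper semicontinuity then puts `demCoqd f y` in a ball of radius `ε < τ` for some nearby
non-minimizer `y`, which contradicts nondegeneracy as soon as `demCoqd f y` is nonempty.

Nonemptiness (`demCoqd_nonempty`) carries the main work: the Clarke derivative of a Lipschitz
function is finite and sublinear, so Hahn-Banach gives it a continuous linear minorant. -/

namespace QuasiDiff

/-! ### Sublinear functions as support functions -/

section Sublinear

variable {X : Type*} [NormedAddCommGroup X] [NormedSpace ℝ X]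

/-- Hahn-Banach: a sublinear function dominated by a multiple of the norm has a continuous linear
minorant that agrees with it at a given point. -/
theorem exists_strongDual_le_eq_at {N : X → ℝ}
    (N_hom : ∀ c : ℝ, 0 < c → ∀ v, N (c • v) = c * N v)
    (N_add : ∀ v w, N (v + w) ≤ N v + N w) {K : ℝ} (hK : ∀ v, N v ≤ K * ‖v‖) (v₀ : X) :
    ∃ L : StrongDual ℝ X, (∀ v, L v ≤ N v) ∧ L v₀ = N v₀ := by
  have N_zero : N 0 = 0 := by
    have := N_hom 2 (by norm_num) 0
    rw [smul_zero] at this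
    linarith
  have key : ∃ g : X →ₗ[ℝ] ℝ, (∀ v, g v ≤ N v) ∧ g v₀ = N v₀ := by
    by_cases hv₀ : v₀ = 0
    · obtain ⟨g, -, hg⟩ := exists_extension_of_le_sublinear (⊥ : X →ₗ.[ℝ] ℝ) N N_hom N_add (by
        rintro ⟨x, hx⟩
        have hx₀ : x = 0 := hx
        have : (⟨x, hx⟩ : (⊥ : X →ₗ.[ℝ] ℝ).domain) = 0 := Subtype.ext hx₀
        rw [this, LinearPMap.map_zero]
        exact N_zero.ge)
      exact ⟨g, hg, by simp [hv₀, N_zero]⟩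
    · obtain ⟨g, hg₁, hg⟩ := exists_extension_of_le_sublinear
        (LinearPMap.mkSpanSingleton v₀ (N v₀) hv₀ : X →ₗ.[ℝ] ℝ) N N_hom N_add (by
          rintro ⟨x, hx⟩
          obtain ⟨c, rfl⟩ := Submodule.mem_span_singleton.1 hx
          have e : LinearPMap.mkSpanSingleton v₀ (N v₀) hv₀ ⟨c • v₀, hx⟩ = c * N v₀ :=
            LinearPMap.mkSpanSingleton'_apply _ _ _ _ _
          rw [e]
          change c * N v₀ ≤ N (c • v₀)
          -- For `c < 0`, use `0 = N 0 ≤ N (c • v₀) + N (-c • v₀)`.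
          rcases lt_trichotomy c 0 with hc | rfl | hc
          · have h1 := N_hom (-c) (by linarith) v₀
            have h2 := N_add (c • v₀) ((-c) • v₀)
            rw [← add_smul, add_neg_cancel, zero_smul, N_zero, h1] at h2
            linarith
          · simp [N_zero]
          · exact (N_hom c hc v₀).ge)
      refine ⟨g, hg, ?_⟩
      have := hg₁ ⟨v₀, Submodule.mem_span_singleton_self v₀⟩
      rw [LinearPMap.mkSpanSingleton_apply] at this
      exact this
  obtain ⟨g, hg, hg₀⟩ := key
  refine ⟨g.mkContinuous K fun v => ?_, hg, hg₀⟩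
  rw [Real.norm_eq_abs, abs_le]
  have h1 := (hg (-v)).trans (hK (-v))
  rw [map_neg, norm_neg] at h1
  exact ⟨by linarith, (hg v).trans (hK v)⟩

namespace IsContSublinear

variable {h : X → ℝ}

theorem map_zero (hh : IsContSublinear h) : h 0 = 0 := by
  simpa using hh.pos_homogeneous 0 0 le_rfl

theorem exists_le_mul_norm (hh : IsContSublinear h) : ∃ K : ℝ, ∀ v, h v ≤ K * ‖v‖ := by
  have h1 : ∀ᶠ v in 𝓝 (0 : X), h v < 1 :=
    hh.continuous.continuousAt.eventually_lt_const (by rw [hh.map_zero]; exact one_pos)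
  obtain ⟨δ, hδ, H⟩ := Metric.nhds_basis_closedBall.eventually_iff.1 h1
  refine ⟨δ⁻¹, fun v => ?_⟩
  rcases eq_or_ne v 0 with rfl | hv
  · simp [hh.map_zero]
  have hv' : 0 < ‖v‖ := norm_pos_iff.2 hv
  have h2 : h ((δ / ‖v‖) • v) < 1 := H (by
    rw [mem_closedBall_zero_iff, norm_smul, Real.norm_of_nonneg (by positivity),
      div_mul_cancel₀ _ hv'.ne'])
  rw [hh.pos_homogeneous _ _ (by positivity)] at h2
  calc h v = δ⁻¹ * ‖v‖ * (δ / ‖v‖ * h v) := by field_simp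
    _ ≤ δ⁻¹ * ‖v‖ * 1 := by gcongr
    _ = δ⁻¹ * ‖v‖ := mul_one _

theorem exists_abs_sub_le (hh : IsContSublinear h) : ∃ K : ℝ, ∀ v w, |h v - h w| ≤ K * ‖v - w‖ := by
  obtain ⟨K, hK⟩ := hh.exists_le_mul_norm
  refine ⟨K, fun v w => abs_le.2 ⟨?_, ?_⟩⟩
  · have h1 := hh.subadditive v (w - v)
    rw [add_sub_cancel] at h1
    have h2 := hK (w - v)
    rw [norm_sub_rev] at h2
    linarith
  · have h1 := hh.subadditive w (v - w)
    rw [add_sub_cancel] at h1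
    linarith [hK (v - w)]

theorem exists_strongDual_le_eq_at (hh : IsContSublinear h) (v₀ : X) :
    ∃ L : StrongDual ℝ X, (∀ v, L v ≤ h v) ∧ L v₀ = h v₀ :=
  hh.exists_le_mul_norm.elim fun _ hK =>
    QuasiDiff.exists_strongDual_le_eq_at (fun c hc v => hh.pos_homogeneous c v hc.le)
      hh.subadditive hK v₀

/-- The set of continuous linear minorants of a continuous sublinear function is nonempty, convex
and weak-star compact. -/
theorem isCompConv (hh : IsContSublinear h) :
    IsCompConv {L : StrongDual ℝ X | ∀ v, L v ≤ h v} where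
  nonempty := (hh.exists_strongDual_le_eq_at 0).imp fun _ hL => hL.1
  convex := by
    intro L hL M hM a b ha hb hab v
    calc a * L v + b * M v ≤ a * h v + b * h v := by
          gcongr
          exacts [hL v, hM v]
      _ = h v := by rw [← add_mul, hab, one_mul]
  weakStarCompact := by
    obtain ⟨K, hK⟩ := hh.exists_le_mul_norm
    have hclosed : IsClosed (WeakDual.toStrongDual ⁻¹' {L : StrongDual ℝ X | ∀ v, L v ≤ h v} :
        Set (WeakDual ℝ X)) := by
      have : (WeakDual.toStrongDual ⁻¹' {L : StrongDual ℝ X | ∀ v, L v ≤ h v} :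
          Set (WeakDual ℝ X)) = ⋂ v, {L : WeakDual ℝ X | L v ≤ h v} := by
        ext L
        simp
      rw [this]
      exact isClosed_iInter fun v => isClosed_le (WeakDual.eval_continuous v) continuous_const
    refine (WeakDual.isCompact_closedBall (𝕜 := ℝ) (0 : StrongDual ℝ X) (max K 0)).of_isClosed_subset
      hclosed fun L hL => ?_
    rw [mem_preimage, mem_closedBall_zero_iff]
    refine ContinuousLinearMap.opNorm_le_bound _ (le_max_right _ _) fun v => ?_
    have h0 : ∀ w, (WeakDual.toStrongDual L) w ≤ max K 0 * ‖w‖ := fun w =>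
      ((hL w).trans (hK w)).trans (by gcongr; exact le_max_left _ _)
    have h1 := h0 (-v)
    rw [_root_.map_neg, norm_neg] at h1
    rw [Real.norm_eq_abs, abs_le]
    exact ⟨by linarith, h0 v⟩

theorem supportFun_eq (hh : IsContSublinear h) :
    supportFun {L : StrongDual ℝ X | ∀ v, L v ≤ h v} = h := by
  funext v
  refine IsGreatest.csSup_eq ⟨?_, ?_⟩
  · obtain ⟨L, hL, hLv⟩ := hh.exists_strongDual_le_eq_at v
    exact ⟨L, hL, hLv⟩
  · rintro _ ⟨L, hL, rfl⟩
    exact hL v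

end IsContSublinear

/-- The sets of linear minorants of `h₁` and `h₂` form a representing pair, since their support
functions recover `h₁` and `h₂`. -/
theorem IsQuasidifferentiableAt.exists_sublinear_demCoqd_eq {f : X → ℝ} {x : X}
    (h : IsQuasidifferentiableAt f x) :
    ∃ h₁ h₂ : X → ℝ, IsContSublinear h₁ ∧ IsContSublinear h₂ ∧
      demCoqd f x = clarkeSubdiff (fun v => h₁ v - h₂ v) 0 := by
  obtain ⟨h₁, h₂, hh₁, hh₂, hd⟩ := h
  refine ⟨h₁, h₂, hh₁, hh₂, ?_⟩
  have hq : IsQuasidifferential f x {L | ∀ v, L v ≤ h₁ v} {L | ∀ v, L v ≤ h₂ v} :=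
    ⟨hh₁.isCompConv, hh₂.isCompConv, by rwa [hh₁.supportFun_eq, hh₂.supportFun_eq]⟩
  rw [demCoqd_eq hq, demyanovDiff, hh₁.supportFun_eq, hh₂.supportFun_eq]

end Sublinear

/-! ### Sublinearity of the Clarke derivative -/

section Clarke

variable {X : Type*} [NormedAddCommGroup X] [NormedSpace ℝ X] {φ : X → ℝ} {K : ℝ}

theorem eventually_snd_pos {Y : Type*} [TopologicalSpace Y] (x : Y) : ∀ᶠ p in 𝓝 x ×ˢ 𝓝[>] (0 : ℝ), 0 < p.2 :=
  tendsto_snd.eventually self_mem_nhdsWithin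

theorem abs_quotient_le (hφ : ∀ v w, |φ v - φ w| ≤ K * ‖v - w‖) (y v : X) {t : ℝ} (ht : 0 < t) :
    |(φ (y + t • v) - φ y) / t| ≤ K * ‖v‖ := by
  rw [abs_div, abs_of_pos ht, div_le_iff₀ ht]
  have := hφ (y + t • v) y
  rw [add_sub_cancel_left, norm_smul, Real.norm_of_nonneg ht.le] at this
  linarith

theorem clarkeDeriv_le_of_eventually {x v : X} {a : ℝ}
    (h : ∀ᶠ p in 𝓝 x ×ˢ 𝓝[>] (0 : ℝ), (φ (p.1 + p.2 • v) - φ p.1) / p.2 ≤ a) :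
    clarkeDeriv φ x v ≤ a :=
  limsup_le_of_le (by isBoundedDefault) (h.mono fun _ hp => EReal.coe_le_coe_iff.2 hp)

theorem eventually_lt_of_clarkeDeriv_lt {x v : X} {a : ℝ} (h : clarkeDeriv φ x v < a) :
    ∀ᶠ p in 𝓝 x ×ˢ 𝓝[>] (0 : ℝ), (φ (p.1 + p.2 • v) - φ p.1) / p.2 < a :=
  (eventually_lt_of_limsup_lt h (by isBoundedDefault)).mono fun _ hp => EReal.coe_lt_coe_iff.1 hp

theorem clarkeDeriv_le_mul_norm (hφ : ∀ v w, |φ v - φ w| ≤ K * ‖v - w‖) (x v : X) :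
    clarkeDeriv φ x v ≤ (K * ‖v‖ : ℝ) :=
  clarkeDeriv_le_of_eventually <| (eventually_snd_pos x).mono fun p hp =>
    (abs_le.1 (abs_quotient_le hφ p.1 v hp)).2

/-- Difference quotients lie in `[-K‖v‖, K‖v‖]`, so the limsup is finite and real arithmetic
applies. -/
theorem coe_toReal_clarkeDeriv (hφ : ∀ v w, |φ v - φ w| ≤ K * ‖v - w‖) (x v : X) :
    ((clarkeDeriv φ x v).toReal : EReal) = clarkeDeriv φ x v := by
  refine EReal.coe_toReal ?_ ?_
  · exact ((clarkeDeriv_le_mul_norm hφ x v).trans_lt (EReal.coe_lt_top _)).ne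
  · have h : ((-(K * ‖v‖) : ℝ) : EReal) ≤ clarkeDeriv φ x v :=
      le_limsup_of_frequently_le (((eventually_snd_pos x).mono fun p hp =>
        EReal.coe_le_coe_iff.2 (abs_le.1 (abs_quotient_le hφ p.1 v hp)).1).frequently)
        (by isBoundedDefault)
    exact ((EReal.bot_lt_coe _).trans_le h).ne'

/-- Split the quotient along `v + w` at `y + t • w`; this moved base point still tends to `x`, which
the limsup over base points allows. -/
theorem toReal_clarkeDeriv_add_le (hφ : ∀ v w, |φ v - φ w| ≤ K * ‖v - w‖) (x v w : X) :
    (clarkeDeriv φ x (v + w)).toReal ≤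
      (clarkeDeriv φ x v).toReal + (clarkeDeriv φ x w).toReal := by
  refine le_of_forall_pos_le_add fun ε hε => ?_
  have hlt : ∀ u, clarkeDeriv φ x u < (((clarkeDeriv φ x u).toReal + ε / 2 : ℝ) : EReal) := by
    intro u
    conv_lhs => rw [← coe_toReal_clarkeDeriv hφ x u]
    exact EReal.coe_lt_coe_iff.2 (by linarith)
  have hshift : Tendsto (fun p : X × ℝ => (p.1 + p.2 • w, p.2)) (𝓝 x ×ˢ 𝓝[>] (0 : ℝ))
      (𝓝 x ×ˢ 𝓝[>] (0 : ℝ)) := by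
    refine Tendsto.prodMk ?_ tendsto_snd
    have h2 : Tendsto (fun p : X × ℝ => p.2) (𝓝 x ×ˢ 𝓝[>] (0 : ℝ)) (𝓝 0) :=
      tendsto_snd.mono_right nhdsWithin_le_nhds
    simpa using tendsto_fst.add (h2.smul_const w)
  rw [← EReal.coe_le_coe_iff, coe_toReal_clarkeDeriv hφ]
  refine clarkeDeriv_le_of_eventually ?_
  filter_upwards [hshift.eventually (eventually_lt_of_clarkeDeriv_lt (hlt v)),
    eventually_lt_of_clarkeDeriv_lt (hlt w)] with p hv hw
  have e : p.1 + p.2 • (v + w) = p.1 + p.2 • w + p.2 • v := by rw [smul_add]; abel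
  have e' : (φ (p.1 + p.2 • (v + w)) - φ p.1) / p.2 =
      (φ (p.1 + p.2 • w + p.2 • v) - φ (p.1 + p.2 • w)) / p.2 +
        (φ (p.1 + p.2 • w) - φ p.1) / p.2 := by
    rw [e]
    ring
  rw [e']
  linarith

/-- Substitute the step `t * c` for `t`. The reverse inequality follows by using `c⁻¹`. -/
theorem toReal_clarkeDeriv_smul_le (hφ : ∀ v w, |φ v - φ w| ≤ K * ‖v - w‖) (x v : X) {c : ℝ}
    (hc : 0 < c) : (clarkeDeriv φ x (c • v)).toReal ≤ c * (clarkeDeriv φ x v).toReal := by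
  refine le_of_forall_pos_le_add fun ε hε => ?_
  have hlt : clarkeDeriv φ x v < (((clarkeDeriv φ x v).toReal + ε / c : ℝ) : EReal) := by
    conv_lhs => rw [← coe_toReal_clarkeDeriv hφ x v]
    exact EReal.coe_lt_coe_iff.2 (by linarith [div_pos hε hc])
  have hscale : Tendsto (fun p : X × ℝ => (p.1, p.2 * c)) (𝓝 x ×ˢ 𝓝[>] (0 : ℝ))
      (𝓝 x ×ˢ 𝓝[>] (0 : ℝ)) := by
    refine Tendsto.prodMk tendsto_fst (tendsto_nhdsWithin_iff.2 ⟨?_, ?_⟩)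
    · have h2 : Tendsto (fun p : X × ℝ => p.2) (𝓝 x ×ˢ 𝓝[>] (0 : ℝ)) (𝓝 0) :=
        tendsto_snd.mono_right nhdsWithin_le_nhds
      simpa using h2.mul_const c
    · exact (eventually_snd_pos x).mono fun p hp => mul_pos hp hc
  rw [← EReal.coe_le_coe_iff, coe_toReal_clarkeDeriv hφ]
  refine clarkeDeriv_le_of_eventually ?_
  filter_upwards [hscale.eventually (eventually_lt_of_clarkeDeriv_lt hlt),
    eventually_snd_pos x] with p hv hp
  rw [smul_smul]
  calc (φ (p.1 + (p.2 * c) • v) - φ p.1) / p.2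
      = c * ((φ (p.1 + (p.2 * c) • v) - φ p.1) / (p.2 * c)) := by field_simp
    _ ≤ c * ((clarkeDeriv φ x v).toReal + ε / c) := by gcongr
    _ = c * (clarkeDeriv φ x v).toReal + ε := by field_simp

theorem toReal_clarkeDeriv_smul (hφ : ∀ v w, |φ v - φ w| ≤ K * ‖v - w‖) (x v : X) {c : ℝ}
    (hc : 0 < c) : (clarkeDeriv φ x (c • v)).toReal = c * (clarkeDeriv φ x v).toReal := by
  refine (toReal_clarkeDeriv_smul_le hφ x v hc).antisymm ?_
  have h := toReal_clarkeDeriv_smul_le hφ x (c • v) (inv_pos.2 hc)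
  rwa [inv_smul_smul₀ hc.ne', inv_mul_eq_div, le_div_iff₀' hc] at h

/-- The Clarke subdifferential of a Lipschitz function is nonempty. -/
theorem clarkeSubdiff_nonempty (hφ : ∀ v w, |φ v - φ w| ≤ K * ‖v - w‖) (x : X) :
    (clarkeSubdiff φ x).Nonempty := by
  obtain ⟨L, hL, -⟩ := exists_strongDual_le_eq_at
    (fun c hc v => toReal_clarkeDeriv_smul hφ x v hc) (toReal_clarkeDeriv_add_le hφ x)
    (K := K) (fun v => by
      rw [← EReal.coe_le_coe_iff, coe_toReal_clarkeDeriv hφ]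
      exact clarkeDeriv_le_mul_norm hφ x v) 0
  refine ⟨L, fun v => ?_⟩
  rw [← coe_toReal_clarkeDeriv hφ]
  exact EReal.coe_le_coe_iff.2 (hL v)

theorem clarkeSubdiff_zero_subset (x : X) : clarkeSubdiff (fun _ : X => (0 : ℝ)) x ⊆ {0} := by
  intro L hL
  have h : ∀ v, L v ≤ 0 := fun v => EReal.coe_le_coe_iff.1 <|
    (hL v).trans (clarkeDeriv_le_of_eventually (Eventually.of_forall fun p => by simp))
  ext v
  have h1 := h (-v)
  rw [map_neg] at h1
  exact le_antisymm (h v) (neg_nonpos.1 h1)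

theorem IsQuasidifferentiableAt.demCoqd_nonempty {f : X → ℝ} {x : X}
    (h : IsQuasidifferentiableAt f x) : (demCoqd f x).Nonempty := by
  obtain ⟨h₁, h₂, hh₁, hh₂, e⟩ := h.exists_sublinear_demCoqd_eq
  obtain ⟨K₁, hK₁⟩ := hh₁.exists_abs_sub_le
  obtain ⟨K₂, hK₂⟩ := hh₂.exists_abs_sub_le
  rw [e]
  refine clarkeSubdiff_nonempty (K := K₁ + K₂) (fun v w => ?_) 0
  calc |h₁ v - h₂ v - (h₁ w - h₂ w)| = |(h₁ v - h₁ w) - (h₂ v - h₂ w)| := by ring_nf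
    _ ≤ |h₁ v - h₁ w| + |h₂ v - h₂ w| := abs_sub _ _
    _ ≤ K₁ * ‖v - w‖ + K₂ * ‖v - w‖ := add_le_add (hK₁ v w) (hK₂ v w)
    _ = (K₁ + K₂) * ‖v - w‖ := by ring

end Clarke

/-! ### Minimizers and Gateaux differentiability -/

section Argmin

variable {X : Type*} [NormedAddCommGroup X] [NormedSpace ℝ X] {f : X → ℝ}

theorem isClosed_argmin {Y : Type*} [TopologicalSpace Y] {f : Y → ℝ}
    (hf : LowerSemicontinuous f) : IsClosed (argmin f) := by
  have : argmin f = ⋂ y, f ⁻¹' Iic (f y) := by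
    ext x
    simp [argmin]
  rw [this]
  exact isClosed_iInter fun y => hf.isClosed_preimage (f y)

/-- At a minimizer where `f` is Gateaux differentiable all directional derivatives vanish. -/
theorem GateauxDifferentiableAt.hasDirDerivAt_zero {x : X} (hf : GateauxDifferentiableAt f x)
    (hx : x ∈ argmin f) (v : X) : HasDirDerivAt f 0 x v := by
  obtain ⟨L, hL⟩ := hf
  have hmin : IsLocalMin (fun t : ℝ => f (x + t • v)) 0 :=
    Eventually.of_forall fun t => by simpa using hx (x + t • v)
  have h0 : L v = 0 := hmin.hasDerivAt_eq_zero (hL v)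
  have h := (hL v).hasDerivWithinAt (s := Ioi 0)
  rw [h0] at h
  have h1 := hasDerivWithinAt_iff_tendsto_slope.1 h
  rw [sdiff_singleton_eq_self (by simp)] at h1
  refine h1.congr fun t => ?_
  simp [slope_def_field]

theorem GateauxDifferentiableAt.demCoqd_subset {x : X} (hf : GateauxDifferentiableAt f x)
    (hx : x ∈ argmin f) : demCoqd f x ⊆ {0} := by
  rintro L ⟨A, B, hAB, hL⟩
  have e : (fun v => supportFun A v - supportFun B v) = fun _ => (0 : ℝ) :=
    funext fun v => tendsto_nhds_unique (hAB.dirDeriv v) (hf.hasDirDerivAt_zero hx v)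
  rw [demyanovDiff, e] at hL
  exact clarkeSubdiff_zero_subset 0 hL

end Argmin

end QuasiDiff

theorem mainTheorem8 {X : Type*} [NormedAddCommGroup X] [NormedSpace ℝ X] [CompleteSpace X]
    (f : X → ℝ) (hlsc : LowerSemicontinuous f)
    (hqd : ∀ x, QuasiDiff.IsQuasidifferentiableAt f x)
    (τ : ℝ≥0∞) (hτ : 0 < τ)
    (hnondeg : Metric.infEDist (0 : StrongDual ℝ X)
      (⋃ x ∈ (QuasiDiff.argmin f)ᶜ, QuasiDiff.demCoqd f x) = τ)
    (husc : ∀ x ∈ QuasiDiff.argmin f, QuasiDiff.NormUSCAt (QuasiDiff.demCoqd f) x) :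
    ∀ x ∈ frontier (QuasiDiff.argmin f), ¬ QuasiDiff.GateauxDifferentiableAt f x := by
  intro x hx hG
  have hxm : x ∈ QuasiDiff.argmin f := (QuasiDiff.isClosed_argmin hlsc).frontier_subset hx
  -- A real radius strictly below `τ`, available also when `τ = ∞`.
  obtain ⟨ε, -, hε, hετ⟩ := ENNReal.lt_iff_exists_real_btwn.1 hτ
  rw [ENNReal.ofReal_pos] at hε
  obtain ⟨δ, hδ, H⟩ := husc x hxm ε hε
  rw [frontier_eq_closure_inter_closure] at hx
  obtain ⟨y, hy, hyx⟩ := Metric.mem_closure_iff.1 hx.2 δ hδ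
  obtain ⟨L, hL⟩ := (hqd y).demCoqd_nonempty
  have h1 : L ∈ Metric.cthickening ε {0} :=
    Metric.cthickening_subset_of_subset ε (hG.demCoqd_subset hxm)
      (H y (by rw [Metric.mem_closedBall, dist_comm]; exact hyx.le) hL)
  rw [Metric.mem_cthickening_iff, Metric.infEDist_singleton, edist_comm] at h1
  have h2 : τ ≤ edist 0 L := hnondeg ▸ Metric.infEDist_le_edist_of_mem (mem_biUnion hy hL)
  exact ((h2.trans h1).trans_lt hετ).false
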